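/- Let $\hbar>0$ and let $\alpha,\beta$ be non-zero complex numbers with $\alpha+\beta\neq 0$. Let $\mathcal A=\mathcal A[\mathbb C^4_\hbar]$ be the unital $*$-algebra over $\mathbb C$ generated by $z_1,\dots,z_4$ (and $z_1^*,\dots,z_4^*$) subject to $$[z_3,z_4]=\mathrm i\hbar(\alpha+\beta)z_1z_2,\quad [z_3,z_3^*]=\mathrm i\hbar\alpha z_1z_1^*-\mathrm i\hbar\beta z_2z_2^*,\quad [z_4,z_4^*]=\mathrm i\hbar\beta z_1z_1^*-\mathrm i\hbar\alpha z_2z_2^*,$$ the adjoints of these relations, and the vanishing of all commutators of the remaining pairs of generators. (The relations are compatible with the $*$-structure without further collapse when $\mathrm i\alpha,\mathrm i\beta$ are real. If $\mathrm i(\alpha+\beta)$ is not real, both spaces below are empty.) A *classical point* is a unital $*$-homomorphism $p:\mathcal A\to\mathbb C$; it is non-zero if some $p(z_j)\ne0$. Let $k\geq 1$, $\mathcal H=\mathcal L=\mathbb C^k$ and $\mathcal K=\mathbb C^{2k+2}$. A *monad* of index $k$ over $\mathbb C^4_\hbar$ is a complex of free right $\mathcal A$-modules $$0\to\mathcal H\otimes\mathcal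 A\xrightarrow{\sigma_z}\mathcal K\otimes\mathcal A\xrightarrow{\tau_z}\mathcal L\otimes\mathcal A\to0,\qquad \sigma_z=\sum_{j}M^j\otimes z_j,\quad \tau_z=\sum_{j}N^j\otimes z_j,$$ with complex matrices $M^j$, $N^j$, such that $\sigma_z$ is injective and such that, at every non-zero classical point $p$, the matrix $\sum_j p(z_j)M^j$ is injective and the matrix $\sum_j p(z_j)N^j$ is surjective. It is *self-conjugate* if $N^1=M^{2\dagger}$, $N^2=-M^{1\dagger}$, $N^3=M^{4\dagger}$, $N^4=-M^{3\dagger}$. A *framing* (at the line at infinity $z_1=z_2=0$) of a self-conjugate monad is a unitary isomorphism $\varphi$ of $\mathbb C^2$ onto $\{v\in\mathcal K: N^3v=N^4v=0\}$, the space of sections of the (trivial) restriction of its cohomology bundle to that line. Two framed self-conjugate monads are *equivalent*, written $\sim$, if they are related by a change of bases $\sigma_z\mapsto U\sigma_zW$, $\tau_z\mapsto W^*\tau_zU^*$, $\varphi\mapsto U\varphi$ with $U\in\mathrm U(\mathcal K)$ and $W\in\mathrm{GL}(\mathcal H)$. Let $\mathfrak M(k;\hbar)$ be the space of framed self-conjugate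 monads of index $k$, topologised as a space of tuples of matrices. **Theorem.** Consider the space of complex matrices $B_1,B_2\in\mathrm M_k(\mathbb C)$, $I\in\mathrm M_{k\times2}(\mathbb C)$ ($k$ rows, $2$ columns) and $J\in\mathrm M_{2\times k}(\mathbb C)$ ($2$ rows, $k$ columns) satisfying 1. $[B_1,B_2]+IJ=0$, 2. $[B_1,B_1^*]+[B_2,B_2^*]+II^*-J^*J=-\mathrm i\hbar(\alpha+\beta)\mathbb 1_k$, with the action $B_i\mapsto gB_ig^{-1}$, $I\mapsto gI$, $J\mapsto Jg^{-1}$ of $g\in\mathrm U(k)$. For each such quadruple, $$M^1=\begin{pmatrix}B_1\\B_2\\J\end{pmatrix},\quad M^2=\begin{pmatrix}-B_2^*\\B_1^*\\I^*\end{pmatrix},\quad M^3=\begin{pmatrix}\mathbb 1_k\\0\\0\end{pmatrix},\quad M^4=\begin{pmatrix}0\\\mathbb 1_k\\0\end{pmatrix},\quad \varphi=\begin{pmatrix}0\\0\\\mathbb 1_2\end{pmatrix},$$ with the $N^j$ determined by self-conjugacy, is a framed self-conjugate monad over $\mathbb C^4_\hbar$, and this assignment induces a bijection (indeed a homeomorphism)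 from the quotient of the space of such quadruples by $\mathrm U(k)$ onto $\mathfrak M(k;\hbar)/\!\sim$. -/

import Mathlib

open Matrix
open scoped ComplexConjugate

noncomputable section

namespace MoyalADHM

/-! ### The coordinate algebra of noncommutative twistor space

The generators `z 0, …, z 3` are the coordinates `z₁, …, z₄`; `zs j` is the adjoint of `z j`. -/

/-- The generators `z₁, …, z₄` and `z₁*, …, z₄*`. -/
inductive Gen : Type
  | z (j : Fin 4)
  | zs (j : Fin 4)

/-- The generator `z_j` in the free algebra. -/
def Z (j : Fin 4) : FreeAlgebra ℂ Gen := FreeAlgebra.ι ℂ (Gen.z j)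

/-- The generator `z_j*` in the free algebra. -/
def Zs (j : Fin 4) : FreeAlgebra ℂ Gen := FreeAlgebra.ι ℂ (Gen.zs j)

/-- The defining relations, for parameters `a = iħα` and `b = iħβ`:
`[z₃, z₄] = (a + b) z₁ z₂`, `[z₃, z₃*] = a z₁ z₁* - b z₂ z₂*`,
`[z₄, z₄*] = b z₁ z₁* - a z₂ z₂*`, together with the adjoints of these three relations (for the
conjugate-linear anti-multiplicative involution that exchanges `z_j` and `z_j*`), while all other
pairs of generators commute. The set of relations is closed under taking adjoints, so that the
quotient is a `*`-algebra. -/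
inductive Rel (a b : ℂ) : FreeAlgebra ℂ Gen → FreeAlgebra ℂ Gen → Prop
  | z_central (j : Fin 4) (hj : j.val < 2) (g : Gen) :
      Rel a b (Z j * FreeAlgebra.ι ℂ g) (FreeAlgebra.ι ℂ g * Z j)
  | zs_central (j : Fin 4) (hj : j.val < 2) (g : Gen) :
      Rel a b (Zs j * FreeAlgebra.ι ℂ g) (FreeAlgebra.ι ℂ g * Zs j)
  | z3_zs4 : Rel a b (Z 2 * Zs 3) (Zs 3 * Z 2)
  | z4_zs3 : Rel a b (Z 3 * Zs 2) (Zs 2 * Z 3)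
  | z3_z4 : Rel a b (Z 2 * Z 3) (Z 3 * Z 2 + (a + b) • (Z 0 * Z 1))
  | zs3_zs4 : Rel a b (Zs 2 * Zs 3) (Zs 3 * Zs 2 - conj (a + b) • (Zs 0 * Zs 1))
  | z3_zs3 : Rel a b (Z 2 * Zs 2) (Zs 2 * Z 2 + a • (Z 0 * Zs 0) - b • (Z 1 * Zs 1))
  | z3_zs3_adj :
      Rel a b (Z 2 * Zs 2) (Zs 2 * Z 2 + conj a • (Z 0 * Zs 0) - conj b • (Z 1 * Zs 1))
  | z4_zs4 : Rel a b (Z 3 * Zs 3) (Zs 3 * Z 3 + b • (Z 0 * Zs 0) - a • (Z 1 * Zs 1))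
  | z4_zs4_adj :
      Rel a b (Z 3 * Zs 3) (Zs 3 * Z 3 + conj b • (Z 0 * Zs 0) - conj a • (Z 1 * Zs 1))

/-- The coordinate algebra of `ℂ⁴_ħ`. -/
abbrev CoordAlg (a b : ℂ) : Type := RingQuot (Rel a b)

/-- The element `z_j` of the coordinate algebra. -/
def coord (a b : ℂ) (j : Fin 4) : CoordAlg a b := RingQuot.mkAlgHom ℂ (Rel a b) (Z j)

/-- The element `z_j*` of the coordinate algebra. -/
def coordStar (a b : ℂ) (j : Fin 4) : CoordAlg a b := RingQuot.mkAlgHom ℂ (Rel a b) (Zs j)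

/-- A nonzero classical point of `ℂ⁴_ħ`: a unital `*`-homomorphism from the coordinate algebra to
`ℂ` that does not vanish on all the coordinates. -/
def IsClassicalPoint {a b : ℂ} (p : CoordAlg a b →ₐ[ℂ] ℂ) : Prop :=
  (∀ j, p (coordStar a b j) = conj (p (coord a b j))) ∧ ∃ j, p (coord a b j) ≠ 0

/-! ### Monads

The vector spaces of the monad are `H = L = ℂᵏ` and `K = ℂ^(2k+2)`, the latter with its
coordinates grouped as `k + k + 2`. -/

/-- The index set of a basis of `K`; it has `2k + 2` elements. -/
abbrev KIdx (k : ℕ) : Type := Fin k ⊕ (Fin k ⊕ Fin 2)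

/-- The constant matrices `(M¹, …, M⁴)`, `(N¹, …, N⁴)` of the monad maps, and a linear map
`φ : ℂ² → K`. -/
abbrev MonadData (k : ℕ) : Type :=
  (Fin 4 → Matrix (KIdx k) (Fin k) ℂ) × (Fin 4 → Matrix (Fin k) (KIdx k) ℂ) ×
    Matrix (KIdx k) (Fin 2) ℂ

/-- The matrix `∑ j, Cʲ ⊗ z_j` with entries in the coordinate algebra. It acts on column vectors
by left multiplication, so it is a homomorphism of free right modules, linear in `z₁, …, z₄`. -/
def linMap (a b : ℂ) {m n : Type} (C : Fin 4 → Matrix m n ℂ) : Matrix m n (CoordAlg a b) :=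
  Matrix.of fun r s => ∑ j, C j r s • coord a b j

/-- The value `∑ j, p(z_j) Cʲ` at a point `p` of the homomorphism `∑ j, Cʲ ⊗ z_j`. -/
def fibreMap {a b : ℂ} (p : CoordAlg a b →ₐ[ℂ] ℂ) {m n : Type}
    (C : Fin 4 → Matrix m n ℂ) : Matrix m n ℂ :=
  ∑ j, p (coord a b j) • C j

/-- `0 → H ⊗ A → K ⊗ A → L ⊗ A → 0`, with maps `σ = ∑ j, Mʲ ⊗ z_j` and `τ = ∑ j, Nʲ ⊗ z_j`, is a
monad over `ℂ⁴_ħ`: it is a complex, `σ` is injective, and at each nonzero classical point `σ` is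
injective and `τ` is surjective on the fibres.

(Surjectivity of `τ` on the modules themselves is impossible for `k > 0`, as the entries of `τ` are
homogeneous of degree one. In the commutative case `a = b = 0` the nonzero classical points are all
the nonzero points of `ℂ⁴`, and this is the usual notion of a monad over `ℂP³`.) -/
structure IsMonad (a b : ℂ) {k : ℕ} (M : Fin 4 → Matrix (KIdx k) (Fin k) ℂ)
    (N : Fin 4 → Matrix (Fin k) (KIdx k) ℂ) : Prop where
  complex : linMap a b N * linMap a b M = 0
  injective : Function.Injective fun v : Fin k → CoordAlg a b => linMap a b M *ᵥ v
  fibre_injective : ∀ p : CoordAlg a b →ₐ[ℂ] ℂ, IsClassicalPoint p →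
    Function.Injective fun v : Fin k → ℂ => fibreMap p M *ᵥ v
  fibre_surjective : ∀ p : CoordAlg a b →ₐ[ℂ] ℂ, IsClassicalPoint p →
    Function.Surjective fun v : KIdx k → ℂ => fibreMap p N *ᵥ v

/-- The monad is self-conjugate, that is `τ_z = (σ_{J(z)})*` and `σ_z = -(τ_{J(z)})*` for the
quaternionic structure `J(z₁, z₂, z₃, z₄) = (-z₂*, z₁*, -z₄*, z₃*)`. -/
def IsSelfConjugate {k : ℕ} (M : Fin 4 → Matrix (KIdx k) (Fin k) ℂ)
    (N : Fin 4 → Matrix (Fin k) (KIdx k) ℂ) : Prop :=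
  N 0 = (M 1)ᴴ ∧ N 1 = -(M 0)ᴴ ∧ N 2 = (M 3)ᴴ ∧ N 3 = -(M 2)ᴴ

/-- The map `φ : ℂ² → K` is a (unitary) framing at infinity. The cohomology bundle of the monad,
restricted to the line at infinity `z₁ = z₂ = 0`, is trivial with space of global sections
`{v ∈ K | N³ v = N⁴ v = 0}`, and `φ` is a unitary isomorphism from `ℂ²` onto this space. -/
def IsFraming {k : ℕ} (N : Fin 4 → Matrix (Fin k) (KIdx k) ℂ)
    (φ : Matrix (KIdx k) (Fin 2) ℂ) : Prop :=
  φᴴ * φ = 1 ∧ ∀ v : KIdx k → ℂ, (N 2 *ᵥ v = 0 ∧ N 3 *ᵥ v = 0) ↔ ∃ w : Fin 2 → ℂ, φ *ᵥ w = v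

/-- The space of framed self-conjugate monads of index `k` over `ℂ⁴_ħ`, topologised as a subspace
of the space of tuples of matrices. -/
abbrev FramedMonad (a b : ℂ) (k : ℕ) : Type :=
  {m : MonadData k // IsMonad a b m.1 m.2.1 ∧ IsSelfConjugate m.1 m.2.1 ∧ IsFraming m.2.1 m.2.2}

/-- Framed monads are equivalent if they are related by changes of bases of `H`, `K`, `L`: a
unitary transformation `U` of `K` and an invertible transformation `W` of `H`, with
`σ ↦ U σ W`, `τ ↦ W* τ U*`, `φ ↦ U φ`. -/
def MonadEquiv {k : ℕ} (m m' : MonadData k) : Prop :=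
  ∃ (U : Matrix.unitaryGroup (KIdx k) ℂ) (W : GL (Fin k) ℂ),
    (∀ j, m'.1 j = (U : Matrix (KIdx k) (KIdx k) ℂ) * m.1 j * (W : Matrix (Fin k) (Fin k) ℂ)) ∧
    (∀ j, m'.2.1 j = (W : Matrix (Fin k) (Fin k) ℂ)ᴴ * m.2.1 j *
      (U : Matrix (KIdx k) (KIdx k) ℂ)ᴴ) ∧
    m'.2.2 = (U : Matrix (KIdx k) (KIdx k) ℂ) * m.2.2

theorem MonadEquiv.refl {k : ℕ} (m : MonadData k) : MonadEquiv m m :=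
  ⟨1, 1, by simp, by simp, by simp⟩

theorem MonadEquiv.symm {k : ℕ} {m m' : MonadData k} (h : MonadEquiv m m') : MonadEquiv m' m := by
  obtain ⟨U, W, h1, h2, h3⟩ := h
  have hU : (U : Matrix (KIdx k) (KIdx k) ℂ)ᴴ * (U : Matrix (KIdx k) (KIdx k) ℂ) = 1 :=
    Matrix.UnitaryGroup.star_mul_self U
  have hW : (W : Matrix (Fin k) (Fin k) ℂ) * ((W⁻¹ : GL (Fin k) ℂ) : Matrix (Fin k) (Fin k) ℂ)
      = 1 := W.mul_inv
  have hW' : ((W⁻¹ : GL (Fin k) ℂ) : Matrix (Fin k) (Fin k) ℂ)ᴴ *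
      (W : Matrix (Fin k) (Fin k) ℂ)ᴴ = 1 := by
    rw [← Matrix.conjTranspose_mul, hW, Matrix.conjTranspose_one]
  have hUi : ((U⁻¹ : Matrix.unitaryGroup (KIdx k) ℂ) : Matrix (KIdx k) (KIdx k) ℂ)
      = (U : Matrix (KIdx k) (KIdx k) ℂ)ᴴ := rfl
  refine ⟨U⁻¹, W⁻¹, fun j => ?_, fun j => ?_, ?_⟩
  · rw [h1, hUi, Matrix.mul_assoc, Matrix.mul_assoc, hW, Matrix.mul_one, ← Matrix.mul_assoc, hU,
      Matrix.one_mul]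
  · rw [h2, hUi, Matrix.conjTranspose_conjTranspose, Matrix.mul_assoc, Matrix.mul_assoc, hU,
      Matrix.mul_one, ← Matrix.mul_assoc, hW', Matrix.one_mul]
  · rw [h3, hUi, ← Matrix.mul_assoc, hU, Matrix.one_mul]

theorem MonadEquiv.trans {k : ℕ} {m m' m'' : MonadData k} (h : MonadEquiv m m')
    (h' : MonadEquiv m' m'') : MonadEquiv m m'' := by
  obtain ⟨U, W, h1, h2, h3⟩ := h
  obtain ⟨U', W', h1', h2', h3'⟩ := h'
  refine ⟨U' * U, W * W', fun j => ?_, fun j => ?_, ?_⟩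
  · rw [h1', h1]; simp [Matrix.mul_assoc]
  · rw [h2', h2]; simp [Matrix.mul_assoc]
  · rw [h3', h3]; simp [Matrix.mul_assoc]

/-- The equivalence relation `∼` on framed self-conjugate monads. -/
instance framedMonadSetoid (a b : ℂ) (k : ℕ) : Setoid (FramedMonad a b k) where
  r m m' := MonadEquiv m.1 m'.1
  iseqv := ⟨fun m => MonadEquiv.refl m.1, fun h => h.symm, fun h h' => h.trans h'⟩

/-! ### The noncommutative ADHM equations -/

/-- Quadruples `(B₁, B₂, I, J)` of matrices; `I` is `k × 2` and `J` is `2 × k`. -/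
abbrev ADHMData (k : ℕ) : Type :=
  Matrix (Fin k) (Fin k) ℂ × Matrix (Fin k) (Fin k) ℂ × Matrix (Fin k) (Fin 2) ℂ ×
    Matrix (Fin 2) (Fin k) ℂ

/-- The equations `[B₁, B₂] + I J = 0` and
`[B₁, B₁*] + [B₂, B₂*] + I I* - J* J = -c 𝟙`. -/
def ADHMEquations (c : ℂ) {k : ℕ} (x : ADHMData k) : Prop :=
  x.1 * x.2.1 - x.2.1 * x.1 + x.2.2.1 * x.2.2.2 = 0 ∧
  (x.1 * x.1ᴴ - x.1ᴴ * x.1) + (x.2.1 * x.2.1ᴴ - x.2.1ᴴ * x.2.1) + x.2.2.1 * x.2.2.1ᴴ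
    - x.2.2.2ᴴ * x.2.2.2 = (-c) • (1 : Matrix (Fin k) (Fin k) ℂ)

/-- The space of solutions of the ADHM equations. -/
abbrev ADHMSolution (c : ℂ) (k : ℕ) : Type := {x : ADHMData k // ADHMEquations c x}

/-- The action `(B₁, B₂, I, J) ↦ (g B₁ g⁻¹, g B₂ g⁻¹, g I, J g⁻¹)` of `U(k)`. -/
def unitaryAct {k : ℕ} (g : Matrix.unitaryGroup (Fin k) ℂ) (x : ADHMData k) : ADHMData k :=
  ((g : Matrix (Fin k) (Fin k) ℂ) * x.1 *
      ((g⁻¹ : Matrix.unitaryGroup (Fin k) ℂ) : Matrix (Fin k) (Fin k) ℂ),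
    (g : Matrix (Fin k) (Fin k) ℂ) * x.2.1 *
      ((g⁻¹ : Matrix.unitaryGroup (Fin k) ℂ) : Matrix (Fin k) (Fin k) ℂ),
    (g : Matrix (Fin k) (Fin k) ℂ) * x.2.2.1,
    x.2.2.2 * ((g⁻¹ : Matrix.unitaryGroup (Fin k) ℂ) : Matrix (Fin k) (Fin k) ℂ))

theorem unitaryAct_one {k : ℕ} (x : ADHMData k) : unitaryAct 1 x = x := by
  simp [unitaryAct]

theorem unitaryAct_mul {k : ℕ} (g h : Matrix.unitaryGroup (Fin k) ℂ) (x : ADHMData k) :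
    unitaryAct (g * h) x = unitaryAct g (unitaryAct h x) := by
  simp only [unitaryAct, _root_.mul_inv_rev, Submonoid.coe_mul, Matrix.mul_assoc]

/-- Two solutions are equivalent if they lie in the same `U(k)`-orbit. -/
instance adhmSetoid (c : ℂ) (k : ℕ) : Setoid (ADHMSolution c k) where
  r x y := ∃ g : Matrix.unitaryGroup (Fin k) ℂ, unitaryAct g x.1 = y.1
  iseqv :=
    ⟨fun x => ⟨1, unitaryAct_one x.1⟩,
     fun {x y} ⟨g, hg⟩ => ⟨g⁻¹, by rw [← hg, ← unitaryAct_mul, inv_mul_cancel, unitaryAct_one]⟩,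
     fun {x y w} ⟨g, hg⟩ ⟨h, hh⟩ => ⟨h * g, by rw [unitaryAct_mul, hg, hh]⟩⟩

/-- The matrices of the monad maps, and the framing, defined by `(B₁, B₂, I, J)`:
`σ = (B₁ z₁ - B₂* z₂ + z₃, B₂ z₁ + B₁* z₂ + z₄, J z₁ + I* z₂)ᵗ`,
`τ = (-B₂ z₁ - B₁* z₂ - z₄, B₁ z₁ - B₂* z₂ + z₃, I z₁ - J* z₂)`, `φ = (0, 0, 𝟙)ᵗ`. -/
def monadOf {k : ℕ} (x : ADHMData k) : MonadData k :=
  (![Matrix.fromRows x.1 (Matrix.fromRows x.2.1 x.2.2.2),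
     Matrix.fromRows (-x.2.1ᴴ) (Matrix.fromRows x.1ᴴ x.2.2.1ᴴ),
     Matrix.fromRows 1 (Matrix.fromRows 0 0),
     Matrix.fromRows 0 (Matrix.fromRows 1 0)],
   ![Matrix.fromCols (-x.2.1) (Matrix.fromCols x.1 x.2.2.1),
     Matrix.fromCols (-x.1ᴴ) (Matrix.fromCols (-x.2.1ᴴ) (-x.2.2.2ᴴ)),
     Matrix.fromCols 0 (Matrix.fromCols 1 0),
     Matrix.fromCols (-1) (Matrix.fromCols 0 0)],
   Matrix.fromRows 0 (Matrix.fromRows 0 1))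

end MoyalADHM

end

/-! Put `a = iħα`, `b = iħβ`. Expanding `τσ` in quadratic monomials, the condition `τσ = 0` becomes
a finite list of matrix equations (`linMap_mul_linMap_eq_zero_iff`). Noncommutativity changes only
the `z₁z₂` coefficient, which gains `(a + b) N³M⁴`. For the matrices of `monadOf` one has `N³M⁴ =
𝟙`, and the list reduces to the ADHM equations with the deformed right-hand side.

The other monad conditions then hold for every solution. Classical points have `z₁ = z₂ = 0`, where
the fibre maps are constant multiples of identity blocks, and `σ` is injective because its first
square block is monic in `z₃`.

Conversely, the equations at infinity say that `M³` and `M⁴` have orthogonal ranges and equal Gram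
matrices `P`, while the framing spans the orthogonal complement of these ranges. Since `P` is
positive definite, `M³P^(-1/2)`, `M⁴P^(-1/2)` and `φ` form an orthonormal basis of `K`, in which the
monad takes the form `monadOf` (`monadEquiv_monadOf_adhmOf`). The changes of basis preserving this
form are exactly those coming from `U(k)`. The map `P ↦ P^(-1/2)` is continuous, so the bijection of
quotients is a homeomorphism. -/

namespace MoyalADHM

/-! ### Inverse square roots of positive definite matrices -/

section InvSqrt

open scoped Matrix.Norms.L2Operator MatrixOrder ComplexOrder

variable {n : Type*} [Fintype n] [DecidableEq n]

/-- The inverse of the positive square root of a matrix. -/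
noncomputable def invSqrt (P : Matrix n n ℂ) : Matrix n n ℂ := (CFC.sqrt P)⁻¹

theorem det_sqrt_ne_zero {P : Matrix n n ℂ} (hP : P.PosDef) : (CFC.sqrt P).det ≠ 0 := by
  intro h
  have h1 : CFC.sqrt P * CFC.sqrt P = P := CFC.sqrt_mul_sqrt_self P hP.posSemidef.nonneg
  have h2 := hP.det_pos.ne'
  rw [← h1, Matrix.det_mul, h, zero_mul] at h2
  exact h2 rfl

theorem isUnit_invSqrt {P : Matrix n n ℂ} (hP : P.PosDef) : IsUnit (invSqrt P) := by
  rw [invSqrt, Matrix.isUnit_iff_isUnit_det, Matrix.isUnit_nonsing_inv_det_iff]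
  exact (det_sqrt_ne_zero hP).isUnit

theorem conjTranspose_invSqrt (P : Matrix n n ℂ) : (invSqrt P)ᴴ = invSqrt P := by
  rw [invSqrt, Matrix.conjTranspose_nonsing_inv, (CFC.sqrt_nonneg P).posSemidef.1.eq]

/-- For a Gram matrix `P = AᴴA` this makes the columns of `A * invSqrt P` orthonormal. -/
theorem invSqrt_mul_mul_invSqrt {P : Matrix n n ℂ} (hP : P.PosDef) :
    invSqrt P * (P * invSqrt P) = 1 := by
  have h1 : CFC.sqrt P * CFC.sqrt P = P := CFC.sqrt_mul_sqrt_self P hP.posSemidef.nonneg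
  have h2 := (det_sqrt_ne_zero hP).isUnit
  rw [invSqrt]
  nth_rw 2 [← h1]
  rw [Matrix.mul_assoc, Matrix.mul_nonsing_inv _ h2, Matrix.mul_one, Matrix.nonsing_inv_mul _ h2]

/-- The square root is continuous by the functional calculus; its inverse is the adjugate divided by
a determinant that never vanishes. -/
theorem continuous_invSqrt {X : Type*} [TopologicalSpace X] {P : X → Matrix n n ℂ}
    (hc : Continuous P) (hP : ∀ x, (P x).PosDef) : Continuous fun x => invSqrt (P x) := by
  have h1 : Continuous fun x => CFC.sqrt (P x) :=
    Continuous.cfcₙ_nnreal_of_mem_nhdsSet (s := Set.univ) NNReal.sqrt Filter.univ_mem hc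
      (fun x => (hP x).posSemidef.nonneg)
  simp only [invSqrt, Matrix.inv_def, Ring.inverse_eq_inv']
  exact (h1.matrix_det.inv₀ fun x => det_sqrt_ne_zero (hP x)).smul h1.matrix_adjugate

end InvSqrt

/-! ### Homomorphisms out of the coordinate algebra, and its quadratic part -/

section Algebra

variable {a b : ℂ}

/-- The algebra homomorphism out of the coordinate algebra with prescribed values `x j` at `z_j`
and `y j` at `z_j*`. -/
noncomputable def coordLift {R : Type*} [Ring R] [Algebra ℂ R] (x y : Fin 4 → R)
    (hx : ∀ j : Fin 4, j.val < 2 → ∀ l, Commute (x j) (x l) ∧ Commute (x j) (y l))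
    (hy : ∀ j : Fin 4, j.val < 2 → ∀ l, Commute (y j) (x l) ∧ Commute (y j) (y l))
    (h1 : Commute (x 2) (y 3)) (h2 : Commute (x 3) (y 2))
    (h3 : x 2 * x 3 = x 3 * x 2 + (a + b) • (x 0 * x 1))
    (h4 : y 2 * y 3 = y 3 * y 2 - conj (a + b) • (y 0 * y 1))
    (h5 : x 2 * y 2 = y 2 * x 2 + a • (x 0 * y 0) - b • (x 1 * y 1))
    (h6 : x 2 * y 2 = y 2 * x 2 + conj a • (x 0 * y 0) - conj b • (x 1 * y 1))
    (h7 : x 3 * y 3 = y 3 * x 3 + b • (x 0 * y 0) - a • (x 1 * y 1))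
    (h8 : x 3 * y 3 = y 3 * x 3 + conj b • (x 0 * y 0) - conj a • (x 1 * y 1)) :
    CoordAlg a b →ₐ[ℂ] R :=
  RingQuot.liftAlgHom ℂ ⟨FreeAlgebra.lift ℂ fun g => match g with
    | Gen.z j => x j
    | Gen.zs j => y j, by
    intro u v h
    induction h with
    | z_central j hj g =>
      cases g
      exacts [by simpa [Z] using (hx j hj _).1.eq, by simpa [Z] using (hx j hj _).2.eq]
    | zs_central j hj g =>
      cases g
      exacts [by simpa [Zs] using (hy j hj _).1.eq, by simpa [Zs] using (hy j hj _).2.eq]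
    | z3_zs4 => simpa [Z, Zs] using h1.eq
    | z4_zs3 => simpa [Z, Zs] using h2.eq
    | z3_z4 => simpa [Z, Zs] using h3
    | zs3_zs4 => simpa [Z, Zs] using h4
    | z3_zs3 => simpa [Z, Zs] using h5
    | z3_zs3_adj => simpa [Z, Zs] using h6
    | z4_zs4 => simpa [Z, Zs] using h7
    | z4_zs4_adj => simpa [Z, Zs] using h8⟩

@[simp]
theorem coordLift_coord {R : Type*} [Ring R] [Algebra ℂ R] {x y : Fin 4 → R}
    {hx hy h1 h2 h3 h4 h5 h6 h7 h8} (j : Fin 4) :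
    coordLift (a := a) (b := b) x y hx hy h1 h2 h3 h4 h5 h6 h7 h8 (coord a b j) = x j := by
  simp [coordLift, coord, Z]

@[simp]
theorem coordLift_coordStar {R : Type*} [Ring R] [Algebra ℂ R] {x y : Fin 4 → R}
    {hx hy h1 h2 h3 h4 h5 h6 h7 h8} (j : Fin 4) :
    coordLift (a := a) (b := b) x y hx hy h1 h2 h3 h4 h5 h6 h7 h8 (coordStar a b j) = y j := by
  simp [coordLift, coordStar, Zs]

theorem commute_coord {j : Fin 4} (hj : j.val < 2) (l : Fin 4) :
    Commute (coord a b j) (coord a b l) := by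
  simpa [coord, Z, Commute, SemiconjBy] using
    RingQuot.mkAlgHom_rel ℂ (Rel.z_central (a := a) (b := b) j hj (Gen.z l))

theorem commute_coord_coordStar {j : Fin 4} (hj : j.val < 2) (l : Fin 4) :
    Commute (coord a b j) (coordStar a b l) := by
  simpa [coord, coordStar, Z, Zs, Commute, SemiconjBy] using
    RingQuot.mkAlgHom_rel ℂ (Rel.z_central (a := a) (b := b) j hj (Gen.zs l))

theorem commute_coordStar_coord {j : Fin 4} (hj : j.val < 2) (l : Fin 4) :
    Commute (coordStar a b j) (coord a b l) := by
  simpa [coord, coordStar, Z, Zs, Commute, SemiconjBy] using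
    RingQuot.mkAlgHom_rel ℂ (Rel.zs_central (a := a) (b := b) j hj (Gen.z l))

theorem commute_coordStar {j : Fin 4} (hj : j.val < 2) (l : Fin 4) :
    Commute (coordStar a b j) (coordStar a b l) := by
  simpa [coordStar, Zs, Commute, SemiconjBy] using
    RingQuot.mkAlgHom_rel ℂ (Rel.zs_central (a := a) (b := b) j hj (Gen.zs l))

theorem commute_coord_two_coordStar_three : Commute (coord a b 2) (coordStar a b 3) := by
  simpa [coord, coordStar, Z, Zs, Commute, SemiconjBy] using
    RingQuot.mkAlgHom_rel ℂ (Rel.z3_zs4 (a := a) (b := b))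

theorem commute_coord_three_coordStar_two : Commute (coord a b 3) (coordStar a b 2) := by
  simpa [coord, coordStar, Z, Zs, Commute, SemiconjBy] using
    RingQuot.mkAlgHom_rel ℂ (Rel.z4_zs3 (a := a) (b := b))

theorem coord_two_mul_coord_three : coord a b 2 * coord a b 3 =
    coord a b 3 * coord a b 2 + (a + b) • (coord a b 0 * coord a b 1) := by
  simpa only [coord, map_mul, map_add, map_smul] using
    RingQuot.mkAlgHom_rel ℂ (Rel.z3_z4 (a := a) (b := b))

theorem coordStar_two_mul_coordStar_three : coordStar a b 2 * coordStar a b 3 =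
    coordStar a b 3 * coordStar a b 2 - conj (a + b) • (coordStar a b 0 * coordStar a b 1) := by
  simpa only [coordStar, map_mul, map_sub, map_smul] using
    RingQuot.mkAlgHom_rel ℂ (Rel.zs3_zs4 (a := a) (b := b))

theorem coord_two_mul_coordStar_two : coord a b 2 * coordStar a b 2 =
    coordStar a b 2 * coord a b 2 + a • (coord a b 0 * coordStar a b 0)
      - b • (coord a b 1 * coordStar a b 1) := by
  simpa only [coord, coordStar, map_mul, map_add, map_sub, map_smul] using
    RingQuot.mkAlgHom_rel ℂ (Rel.z3_zs3 (a := a) (b := b))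

theorem coord_two_mul_coordStar_two' : coord a b 2 * coordStar a b 2 =
    coordStar a b 2 * coord a b 2 + conj a • (coord a b 0 * coordStar a b 0)
      - conj b • (coord a b 1 * coordStar a b 1) := by
  simpa only [coord, coordStar, map_mul, map_add, map_sub, map_smul] using
    RingQuot.mkAlgHom_rel ℂ (Rel.z3_zs3_adj (a := a) (b := b))

theorem coord_three_mul_coordStar_three : coord a b 3 * coordStar a b 3 =
    coordStar a b 3 * coord a b 3 + b • (coord a b 0 * coordStar a b 0)
      - a • (coord a b 1 * coordStar a b 1) := by
  simpa only [coord, coordStar, map_mul, map_add, map_sub, map_smul] using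
    RingQuot.mkAlgHom_rel ℂ (Rel.z4_zs4 (a := a) (b := b))

theorem coord_three_mul_coordStar_three' : coord a b 3 * coordStar a b 3 =
    coordStar a b 3 * coord a b 3 + conj b • (coord a b 0 * coordStar a b 0)
      - conj a • (coord a b 1 * coordStar a b 1) := by
  simpa only [coord, coordStar, map_mul, map_add, map_sub, map_smul] using
    RingQuot.mkAlgHom_rel ℂ (Rel.z4_zs4_adj (a := a) (b := b))

theorem coordAlg_hom_ext {R : Type*} [Semiring R] [Algebra ℂ R] {f g : CoordAlg a b →ₐ[ℂ] R}
    (h : ∀ j, f (coord a b j) = g (coord a b j))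
    (h' : ∀ j, f (coordStar a b j) = g (coordStar a b j)) : f = g := by
  refine RingQuot.ringQuot_ext' ℂ f g (FreeAlgebra.hom_ext (funext fun x => ?_))
  cases x with
  | z j => exact h j
  | zs j => exact h' j

/-- The product of two linear matrices, expanded into quadratic monomials. -/
theorem linMap_mul_apply {l m n : Type} [Fintype m] (N : Fin 4 → Matrix l m ℂ)
    (M : Fin 4 → Matrix m n ℂ) (r : l) (t : n) :
    (linMap a b N * linMap a b M) r t =
      ∑ i, ∑ j, (N i * M j) r t • (coord a b i * coord a b j) := by
  simp only [Matrix.mul_apply, linMap, Matrix.of_apply, Finset.sum_mul_sum, Finset.sum_smul,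
    smul_mul_smul_comm]
  rw [Finset.sum_comm]
  exact Finset.sum_congr rfl fun i _ => Finset.sum_comm

/-! ### Classical points -/

/-- All classical points lie on the line at infinity. -/
theorem IsClassicalPoint.coord_eq_zero (ha : a ≠ 0) (hb : b ≠ 0) (hab : a + b ≠ 0)
    {p : CoordAlg a b →ₐ[ℂ] ℂ} (hp : IsClassicalPoint p) :
    p (coord a b 0) = 0 ∧ p (coord a b 1) = 0 := by
  have h1 := congrArg p (coord_two_mul_coord_three (a := a) (b := b))
  have h2 := congrArg p (coord_two_mul_coordStar_two (a := a) (b := b))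
  simp only [map_mul, map_add, map_sub, map_smul, hp.1, smul_eq_mul] at h1 h2
  -- Commutators vanish in `ℂ`, so `[z₃, z₄]` forces `z₁z₂ = 0`; then `[z₃, z₃*]` leaves a nonzero
  -- multiple of `|z₂|²` or of `|z₁|²`.
  have h3 : p (coord a b 0) * p (coord a b 1) = 0 := by
    refine (mul_eq_zero.mp ?_).resolve_left hab
    linear_combination -h1
  rcases mul_eq_zero.mp h3 with h | h
  · refine ⟨h, ?_⟩
    have : b * (p (coord a b 1) * conj (p (coord a b 1))) = 0 := by
      rw [h] at h2; linear_combination h2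
    simpa [hb] using this
  · refine ⟨?_, h⟩
    have : a * (p (coord a b 0) * conj (p (coord a b 0))) = 0 := by
      rw [h] at h2; linear_combination -h2
    simpa [ha] using this

/-- The classical point `(0, 0, 1, 0)`. -/
noncomputable def pointTwo (a b : ℂ) : CoordAlg a b →ₐ[ℂ] ℂ :=
  coordLift ![0, 0, 1, 0] ![0, 0, 1, 0] (fun _ _ _ => ⟨mul_comm _ _, mul_comm _ _⟩)
    (fun _ _ _ => ⟨mul_comm _ _, mul_comm _ _⟩) (mul_comm _ _) (mul_comm _ _)
    (by simp) (by simp) (by simp) (by simp) (by simp) (by simp)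

theorem pointTwo_coord (j : Fin 4) :
    pointTwo a b (coord a b j) = (![0, 0, 1, 0] : Fin 4 → ℂ) j := coordLift_coord j

theorem pointTwo_coordStar (j : Fin 4) :
    pointTwo a b (coordStar a b j) = (![0, 0, 1, 0] : Fin 4 → ℂ) j := coordLift_coordStar j

theorem isClassicalPoint_pointTwo : IsClassicalPoint (pointTwo a b) := by
  refine ⟨fun j => ?_, 2, by simp [pointTwo_coord]⟩
  rw [pointTwo_coord, pointTwo_coordStar]
  fin_cases j <;> simp

theorem fibreMap_pointTwo {m n : Type} (C : Fin 4 → Matrix m n ℂ) :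
    fibreMap (pointTwo a b) C = C 2 := by
  simp [fibreMap, pointTwo_coord, Fin.sum_univ_four]

/-! ### Independence of the quadratic monomials -/

/-- A matrix algebra in which the coordinates `z_j` multiply according to a bilinear form `f`. -/
def quadMatrix (f : Fin 4 → Fin 4 → ℂ) (j : Fin 4) :
    Matrix (Unit ⊕ Fin 4 ⊕ Unit) (Unit ⊕ Fin 4 ⊕ Unit) ℂ :=
  Matrix.fromBlocks 0 (Matrix.of fun _ => Sum.elim (Pi.single j 1) 0) 0
    (Matrix.fromBlocks 0 (Matrix.of fun i _ => f i j) 0 0)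

/-- The matrices are strictly block upper triangular for sizes 1, 4, 1, so a product of two survives
only in the corner. -/
theorem quadMatrix_mul (f : Fin 4 → Fin 4 → ℂ) (i j : Fin 4) :
    quadMatrix f i * quadMatrix f j =
      f i j • Matrix.fromBlocks 0 (Matrix.of fun _ => Sum.elim 0 1) 0 0 := by
  simp only [quadMatrix, Matrix.fromBlocks_multiply, Matrix.fromBlocks_smul]
  congr 1
  · simp
  · ext r (s | s) <;> simp [Matrix.mul_apply, Matrix.fromBlocks, Pi.single_apply]
  · simp
  · simp

/-- If a quadratic expression in the coordinates vanishes, so does its evaluation on any bilinear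
form that is compatible with the commutation relations. -/
theorem sum_eq_zero_of_quadratic_eq_zero {q : Fin 4 → Fin 4 → ℂ}
    (hq : ∑ i, ∑ j, q i j • (coord a b i * coord a b j) = 0) (f : Fin 4 → Fin 4 → ℂ)
    (hf : ∀ i j : Fin 4, i.val < 2 → f i j = f j i)
    (hf' : f 2 3 = f 3 2 + (a + b) * f 0 1) : ∑ i, ∑ j, q i j * f i j = 0 := by
  -- Sending every `z_j*` to zero trivialises the relations that involve adjoints. The corner entry
  -- of the image of `z_i z_j` is `f i j`.
  let ψ : CoordAlg a b →ₐ[ℂ] Matrix (Unit ⊕ Fin 4 ⊕ Unit) (Unit ⊕ Fin 4 ⊕ Unit) ℂ :=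
    coordLift (quadMatrix f) 0
      (fun i hi j => ⟨by simp [Commute, SemiconjBy, quadMatrix_mul, hf i j hi], by simp⟩)
      (fun i hi j => ⟨by simp, by simp⟩) (by simp) (by simp)
      (by simp only [quadMatrix_mul, hf', add_smul, mul_smul]) (by simp) (by simp) (by simp)
      (by simp) (by simp)
  have h := congrArg (fun x => ψ x (Sum.inl ()) (Sum.inr (Sum.inr ()))) hq
  simpa [ψ, quadMatrix_mul, Matrix.sum_apply] using h

/-! ### Injectivity of monic linear maps -/

/-- Translation of the coordinate `z₃` by a central variable. -/
noncomputable def shift (a b : ℂ) : CoordAlg a b →ₐ[ℂ] Polynomial (CoordAlg a b) :=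
  -- The variable `X` is central, so adding it to `z₃` changes no commutator. The image of `z₃*`
  -- stays fixed: compatibility with adjoints is not required here.
  coordLift (fun j => Polynomial.C (coord a b j) + if j = 2 then Polynomial.X else 0)
    (fun j => Polynomial.C (coordStar a b j))
    (fun j hj l => by
      have hj2 : j ≠ 2 := by rintro rfl; simp at hj
      simp only [hj2, if_false, add_zero]
      refine ⟨((commute_coord hj l).map Polynomial.C).add_right ?_,
        (commute_coord_coordStar hj l).map Polynomial.C⟩
      split_ifs
      · exact (Polynomial.commute_X _).symm
      · exact Commute.zero_right _)
    (fun j hj l => by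
      refine ⟨((commute_coordStar_coord hj l).map Polynomial.C).add_right ?_,
        (commute_coordStar hj l).map Polynomial.C⟩
      split_ifs
      · exact (Polynomial.commute_X _).symm
      · exact Commute.zero_right _)
    (by
      simp only [if_true]
      exact (commute_coord_two_coordStar_three.map Polynomial.C).add_left (Polynomial.commute_X _))
    (by simpa using commute_coord_three_coordStar_two.map Polynomial.C)
    (by
      have h := congrArg Polynomial.C (coord_two_mul_coord_three (a := a) (b := b))
      simp only [map_mul, map_add, ← Polynomial.smul_C] at h
      simp [add_mul, mul_add, Polynomial.X_mul_C, h]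
      abel)
    (by
      have h := congrArg Polynomial.C (coordStar_two_mul_coordStar_three (a := a) (b := b))
      simpa [← Polynomial.smul_C] using h)
    (by
      have h := congrArg Polynomial.C (coord_two_mul_coordStar_two (a := a) (b := b))
      simp only [map_mul, map_add, map_sub, ← Polynomial.smul_C] at h
      simp [add_mul, mul_add, Polynomial.X_mul_C, h]
      abel)
    (by
      have h := congrArg Polynomial.C (coord_two_mul_coordStar_two' (a := a) (b := b))
      simp only [map_mul, map_add, map_sub, ← Polynomial.smul_C] at h
      simp [add_mul, mul_add, Polynomial.X_mul_C, h]
      abel)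
    (by
      have h := congrArg Polynomial.C (coord_three_mul_coordStar_three (a := a) (b := b))
      simpa [← Polynomial.smul_C] using h)
    (by
      have h := congrArg Polynomial.C (coord_three_mul_coordStar_three' (a := a) (b := b))
      simpa [← Polynomial.smul_C] using h)

theorem shift_coord (j : Fin 4) : shift a b (coord a b j) =
    Polynomial.C (coord a b j) + if j = 2 then Polynomial.X else 0 := coordLift_coord j

theorem shift_coordStar (j : Fin 4) :
    shift a b (coordStar a b j) = Polynomial.C (coordStar a b j) := coordLift_coordStar j

/-- Polynomials over the coordinate algebra, evaluated at zero. -/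
noncomputable def evalZero (a b : ℂ) : Polynomial (CoordAlg a b) →ₐ[ℂ] CoordAlg a b :=
  { Polynomial.constantCoeff with
    commutes' := fun r => by simp [Polynomial.algebraMap_apply] }

theorem evalZero_apply (p : Polynomial (CoordAlg a b)) : evalZero a b p = p.coeff 0 := rfl

/-- Setting `X = 0` undoes the translation. -/
theorem coeff_zero_shift (x : CoordAlg a b) : (shift a b x).coeff 0 = x := by
  have : (evalZero a b).comp (shift a b) = AlgHom.id ℂ (CoordAlg a b) := by
    refine coordAlg_hom_ext (fun j => ?_) fun j => ?_
    · simp only [AlgHom.comp_apply, shift_coord, evalZero_apply, AlgHom.id_apply]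
      split_ifs <;> simp
    · simp [AlgHom.comp_apply, shift_coordStar, evalZero_apply]
  exact congrArg (fun f => f x) this

theorem shift_injective : Function.Injective (shift a b) :=
  Function.LeftInverse.injective (g := evalZero a b) coeff_zero_shift

/-- A vector of polynomials annihilated by `X + D`, with `D` a constant matrix, is zero. -/
theorem eq_zero_of_X_mul_add_eq_zero {R n : Type*} [Ring R] [Fintype n] (D : n → n → R)
    (w : n → Polynomial R)
    (h : ∀ r, Polynomial.X * w r + ∑ s, Polynomial.C (D r s) * w s = 0) : w = 0 := by
  -- Downward induction on `m`, run as induction on `d`: the coefficient of `X^(m+1)` in the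
  -- equation expresses the `m`-th coefficients of `w` through the `(m+1)`-st, and these vanish
  -- beyond all the degrees.
  have key : ∀ d m, (Finset.univ.sup fun r => (w r).natDegree) < m + d →
      ∀ r, (w r).coeff m = 0 := by
    intro d
    induction d with
    | zero =>
      intro m hm r
      exact Polynomial.coeff_eq_zero_of_natDegree_lt
        ((Finset.le_sup (f := fun r => (w r).natDegree) (Finset.mem_univ r)).trans_lt hm)
    | succ d ih =>
      intro m hm r
      have h1 := congrArg (fun p => p.coeff (m + 1)) (h r)
      simpa [Polynomial.finsetSum_coeff, ih (m + 1) (by omega)] using h1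
  ext r m
  exact key _ m (Nat.lt_add_left m (Nat.lt_succ_self _)) r

/-- The matrix of a linear map whose coefficient of `z₃` is the identity matrix is injective. -/
theorem eq_zero_of_linMap_mulVec_eq_zero {n : Type} [Fintype n] [DecidableEq n]
    (C : Fin 4 → Matrix n n ℂ) (h2 : C 2 = 1) (v : n → CoordAlg a b)
    (h : linMap a b C *ᵥ v = 0) : v = 0 := by
  -- After translation the matrix becomes `X + D`, where `D` is the original matrix with constant
  -- entries; no basis of the coordinate algebra is needed.
  have hw : (fun r => shift a b (v r)) = 0 := by
    refine eq_zero_of_X_mul_add_eq_zero (fun r s => linMap a b C r s) _ fun r => ?_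
    have h1 := congrArg (shift a b) (congrFun h r)
    have h3 : ∀ s, shift a b (linMap a b C r s) =
        Polynomial.C (linMap a b C r s) + if r = s then Polynomial.X else 0 := by
      intro s
      simp only [linMap, Matrix.of_apply, map_sum, map_smul, shift_coord, smul_add,
        Finset.sum_add_distrib, Polynomial.smul_C]
      congr 1
      simp [h2, Matrix.one_apply]
    simp only [Matrix.mulVec, dotProduct, map_sum, map_mul, h3, add_mul, Finset.sum_add_distrib,
      Pi.zero_apply, map_zero] at h1
    rw [← h1, add_comm]
    simp
  funext r
  exact shift_injective (by simpa using congrFun hw r)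

end Algebra
end MoyalADHM

namespace MoyalADHM

variable {a b : ℂ} {k : ℕ}

/-! ### The monad of an ADHM datum -/

/-- The products of coefficients that vanish in a complex of linear maps. -/
theorem linMap_mul_linMap_eq_zero_iff {l m n : Type} [Fintype m] {N : Fin 4 → Matrix l m ℂ}
    {M : Fin 4 → Matrix m n ℂ} :
    linMap a b N * linMap a b M = 0 ↔
      (∀ i, N i * M i = 0) ∧
      N 0 * M 2 + N 2 * M 0 = 0 ∧ N 0 * M 3 + N 3 * M 0 = 0 ∧
      N 1 * M 2 + N 2 * M 1 = 0 ∧ N 1 * M 3 + N 3 * M 1 = 0 ∧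
      N 2 * M 3 + N 3 * M 2 = 0 ∧ N 0 * M 1 + N 1 * M 0 + (a + b) • (N 2 * M 3) = 0 := by
  constructor
  · intro h
    -- Each bilinear form compatible with the relations yields one matrix equation.
    have key : ∀ f : Fin 4 → Fin 4 → ℂ, (∀ i j : Fin 4, i.val < 2 → f i j = f j i) →
        f 2 3 = f 3 2 + (a + b) * f 0 1 → ∑ i, ∑ j, f i j • (N i * M j) = 0 := by
      intro f hf hf'
      ext r t
      have h1 := congrFun (congrFun h r) t
      rw [linMap_mul_apply] at h1
      have h2 := sum_eq_zero_of_quadratic_eq_zero h1 f hf hf'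
      simpa [Matrix.sum_apply, mul_comm] using h2
    -- Symmetric forms without a `z₁z₂` entry do not see the deformation; they give the commutative
    -- equations.
    have sym : ∀ u v : Fin 4 → ℂ, u 0 * v 1 + u 1 * v 0 = 0 →
        ∑ i, ∑ j, (u i * v j + u j * v i) • (N i * M j) = 0 := fun u v huv =>
      key _ (fun i j _ => add_comm _ _) (by rw [huv]; ring)
    refine ⟨fun i => ?_, ?_, ?_, ?_, ?_, ?_, ?_⟩
    · have := sym (Pi.single i 1) (Pi.single i 1) (by fin_cases i <;> simp)
      have h2 : (2 : ℂ) • (N i * M i) = 0 := by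
        fin_cases i <;> simpa [Fin.sum_univ_four, one_add_one_eq_two] using this
      simpa using h2
    · simpa [Fin.sum_univ_four] using sym (Pi.single 0 1) (Pi.single 2 1) (by simp)
    · simpa [Fin.sum_univ_four] using sym (Pi.single 0 1) (Pi.single 3 1) (by simp)
    · simpa [Fin.sum_univ_four] using sym (Pi.single 1 1) (Pi.single 2 1) (by simp)
    · simpa [Fin.sum_univ_four] using sym (Pi.single 1 1) (Pi.single 3 1) (by simp)
    · simpa [Fin.sum_univ_four] using sym (Pi.single 2 1) (Pi.single 3 1) (by simp)
    -- A form with `f 0 1 = 1` needs `f 2 3 - f 3 2 = a + b`; placing all of it in `f 2 3` gives the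
    -- term `(a + b) N³M⁴`.
    · have := key ![![0, 1, 0, 0], ![1, 0, 0, 0], ![0, 0, 0, a + b], ![0, 0, 0, 0]]
        (fun i j hi => by fin_cases i <;> fin_cases j <;> simp_all) (by simp)
      simpa [Fin.sum_univ_four] using this
  · rintro ⟨h, h02, h03, h12, h13, h23, h01⟩
    ext r t
    have e := fun i => congrFun (congrFun (h i) r) t
    have e02 := congrFun (congrFun h02 r) t
    have e03 := congrFun (congrFun h03 r) t
    have e12 := congrFun (congrFun h12 r) t
    have e13 := congrFun (congrFun h13 r) t
    have e23 := congrFun (congrFun h23 r) t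
    have e01 := congrFun (congrFun h01 r) t
    have e0 := e 0
    have e1 := e 1
    have e2 := e 2
    have e3 := e 3
    simp only [Matrix.add_apply, Matrix.zero_apply, Matrix.smul_apply, smul_eq_mul]
      at e0 e1 e2 e3 e02 e03 e12 e13 e23 e01
    rw [linMap_mul_apply]
    simp only [Fin.sum_univ_four, Matrix.zero_apply, e0, e1, e2, e3]
    have c10 := (commute_coord (a := a) (b := b) (j := 0) (by simp) 1).eq
    have c20 := (commute_coord (a := a) (b := b) (j := 0) (by simp) 2).eq
    have c30 := (commute_coord (a := a) (b := b) (j := 0) (by simp) 3).eq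
    have c21 := (commute_coord (a := a) (b := b) (j := 1) (by simp) 2).eq
    have c31 := (commute_coord (a := a) (b := b) (j := 1) (by simp) 3).eq
    rw [← c10, ← c20, ← c30, ← c21, ← c31, coord_two_mul_coord_three]
    linear_combination (norm := module) e02 • (coord a b 0 * coord a b 2)
      + e03 • (coord a b 0 * coord a b 3) + e12 • (coord a b 1 * coord a b 2)
      + e13 • (coord a b 1 * coord a b 3) + e23 • (coord a b 3 * coord a b 2)
      + e01 • (coord a b 0 * coord a b 1)

theorem isSelfConjugate_monadOf (x : ADHMData k) :
    IsSelfConjugate (monadOf x).1 (monadOf x).2.1 := by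
  simp [IsSelfConjugate, monadOf, Matrix.conjTranspose_fromRows_eq_fromCols_conjTranspose,
    Matrix.fromCols_neg]

theorem isFraming_monadOf (x : ADHMData k) : IsFraming (monadOf x).2.1 (monadOf x).2.2 := by
  refine ⟨?_, fun v => ⟨fun h => ⟨fun i => v (Sum.inr (Sum.inr i)), ?_⟩, ?_⟩⟩
  · simp [monadOf, Matrix.conjTranspose_fromRows_eq_fromCols_conjTranspose,
      Matrix.fromCols_mul_fromRows]
  · obtain ⟨h2, h3⟩ := h
    ext (r | r | r)
    · have := congrFun h3 r
      simp [monadOf, Matrix.fromCols_mulVec, Matrix.neg_mulVec] at this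
      simp [monadOf, Matrix.fromRows_mulVec, this]
    · have := congrFun h2 r
      simp [monadOf, Matrix.fromCols_mulVec] at this
      simp [monadOf, Matrix.fromRows_mulVec, this]
    · simp [monadOf, Matrix.fromRows_mulVec]
  · rintro ⟨w, rfl⟩
    simp [monadOf]

/-- The `z₁²` coefficient is the first ADHM equation, that of `z₂²` is minus its adjoint, and that
of `z₁z₂` is the second equation. The remaining coefficients vanish identically. -/
theorem linMap_monadOf_mul_eq_zero_iff (x : ADHMData k) :
    linMap a b (monadOf x).2.1 * linMap a b (monadOf x).1 = 0 ↔ ADHMEquations (a + b) x := by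
  obtain ⟨B₁, B₂, I, J⟩ := x
  have e00 : (monadOf (B₁, B₂, I, J)).2.1 0 * (monadOf (B₁, B₂, I, J)).1 0 =
      B₁ * B₂ - B₂ * B₁ + I * J := by
    simp only [monadOf, Matrix.cons_val_zero, Matrix.fromCols_mul_fromRows, Matrix.neg_mul]
    abel
  have e11 : (monadOf (B₁, B₂, I, J)).2.1 1 * (monadOf (B₁, B₂, I, J)).1 1 =
      -(B₁ * B₂ - B₂ * B₁ + I * J)ᴴ := by
    simp only [monadOf, Matrix.cons_val_one, Matrix.cons_val_zero, Matrix.fromCols_mul_fromRows,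
      Matrix.neg_mul, Matrix.mul_neg, Matrix.conjTranspose_add, Matrix.conjTranspose_sub,
      Matrix.conjTranspose_mul]
    abel
  have e01 : (monadOf (B₁, B₂, I, J)).2.1 0 * (monadOf (B₁, B₂, I, J)).1 1 +
      (monadOf (B₁, B₂, I, J)).2.1 1 * (monadOf (B₁, B₂, I, J)).1 0 +
      (a + b) • ((monadOf (B₁, B₂, I, J)).2.1 2 * (monadOf (B₁, B₂, I, J)).1 3) =
      (B₁ * B₁ᴴ - B₁ᴴ * B₁) + (B₂ * B₂ᴴ - B₂ᴴ * B₂) + I * Iᴴ - Jᴴ * J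
        - (-(a + b)) • (1 : Matrix (Fin k) (Fin k) ℂ) := by
    rw [neg_smul]
    generalize a + b = c
    simp [monadOf, Matrix.fromCols_mul_fromRows]
    abel
  rw [linMap_mul_linMap_eq_zero_iff, e01, sub_eq_zero]
  refine ⟨fun h => ⟨e00 ▸ h.1 0, h.2.2.2.2.2.2⟩, fun h => ⟨?_, ?_, ?_, ?_, ?_, ?_, h.2⟩⟩
  · have h0 : B₁ * B₂ - B₂ * B₁ + I * J = 0 := h.1
    rw [h0] at e00 e11
    refine Fin.forall_fin_succ.mpr ⟨e00, Fin.forall_fin_succ.mpr ⟨by simpa using e11, ?_⟩⟩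
    simp [Fin.forall_fin_two, monadOf, Matrix.fromCols_mul_fromRows]
  all_goals simp [monadOf, Matrix.fromCols_mul_fromRows]

/-- No stability condition on the datum enters: at a nonzero classical point the fibre maps are
`(z₃, z₄, 0)ᵗ` and `(-z₄, z₃, 0)`, with `z₃` or `z₄` nonzero. -/
theorem isMonad_monadOf (ha : a ≠ 0) (hb : b ≠ 0) (hab : a + b ≠ 0) {x : ADHMData k}
    (hx : ADHMEquations (a + b) x) : IsMonad a b (monadOf x).1 (monadOf x).2.1 where
  complex := (linMap_monadOf_mul_eq_zero_iff x).mpr hx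
  injective := by
    intro v w h
    rw [← sub_eq_zero]
    -- The first `k` rows of `σ` form the square matrix `B₁z₁ - B₂*z₂ + z₃`.
    refine eq_zero_of_linMap_mulVec_eq_zero ![x.1, -x.2.1ᴴ, 1, 0] rfl _ (funext fun r => ?_)
    rw [Matrix.mulVec_sub, Pi.sub_apply, Pi.zero_apply, sub_eq_zero]
    have e : ∀ u, (linMap a b (monadOf x).1 *ᵥ u) (Sum.inl r) =
        (linMap a b ![x.1, -x.2.1ᴴ, 1, 0] *ᵥ u) r := by
      intro u
      refine congrArg (· ⬝ᵥ u) (funext fun s => ?_)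
      simp only [linMap, Matrix.of_apply, Fin.sum_univ_four]
      rfl
    rw [← e, ← e]
    exact congrFun h (Sum.inl r)
  fibre_injective := by
    intro p hp v w h
    obtain ⟨h0, h1⟩ := hp.coord_eq_zero ha hb hab
    have h2 : p (coord a b 2) ≠ 0 ∨ p (coord a b 3) ≠ 0 := by
      obtain ⟨j, hj⟩ := hp.2
      fin_cases j <;> simp_all
    simp only [fibreMap, Fin.sum_univ_four, h0, h1, zero_smul, zero_add, monadOf] at h
    funext r
    rcases h2 with h2 | h2
    · have := congrFun h (Sum.inl r)
      simpa [Matrix.add_mulVec, Matrix.smul_mulVec, Matrix.fromRows_mulVec, h2] using this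
    · have := congrFun h (Sum.inr (Sum.inl r))
      simpa [Matrix.add_mulVec, Matrix.smul_mulVec, Matrix.fromRows_mulVec, h2] using this
  fibre_surjective := by
    intro p hp v
    obtain ⟨h0, h1⟩ := hp.coord_eq_zero ha hb hab
    have h2 : p (coord a b 2) ≠ 0 ∨ p (coord a b 3) ≠ 0 := by
      obtain ⟨j, hj⟩ := hp.2
      fin_cases j <;> simp_all
    rcases h2 with h2 | h2
    · refine ⟨Sum.elim 0 (Sum.elim ((p (coord a b 2))⁻¹ • v) 0), ?_⟩
      simp [fibreMap, Fin.sum_univ_four, h0, h1, monadOf, Matrix.add_mulVec, Matrix.smul_mulVec, h2]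
    · refine ⟨Sum.elim (-(p (coord a b 3))⁻¹ • v) 0, ?_⟩
      simp [fibreMap, Fin.sum_univ_four, h0, h1, monadOf, Matrix.add_mulVec, Matrix.smul_mulVec, h2,
        Matrix.neg_mulVec]

end MoyalADHM

namespace MoyalADHM

variable {a b : ℂ} {k : ℕ}

/-! ### Equivalences of self-conjugate monads -/

/-- For self-conjugate monads, the transformation law of `τ` follows from that of `σ`. -/
theorem MonadEquiv.of_isSelfConjugate {m m' : MonadData k} (h : IsSelfConjugate m.1 m.2.1)
    (h' : IsSelfConjugate m'.1 m'.2.1) {U : Matrix.unitaryGroup (KIdx k) ℂ} {W : GL (Fin k) ℂ}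
    (hM : ∀ j, m'.1 j = (U : Matrix (KIdx k) (KIdx k) ℂ) * m.1 j * (W : Matrix (Fin k) (Fin k) ℂ))
    (hφ : m'.2.2 = (U : Matrix (KIdx k) (KIdx k) ℂ) * m.2.2) : MonadEquiv m m' := by
  obtain ⟨e0, e1, e2, e3⟩ := h
  obtain ⟨e0', e1', e2', e3'⟩ := h'
  refine ⟨U, W, hM, ?_, hφ⟩
  simp only [Fin.forall_fin_succ, IsEmpty.forall_iff, and_true]
  refine ⟨?_, ?_, ?_, ?_⟩
  · exact e0'.trans (by rw [hM, e0]; simp [Matrix.conjTranspose_mul, Matrix.mul_assoc])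
  · exact e1'.trans (by
      rw [hM, show m.2.1 (Fin.succ 0) = _ from e1]
      simp [Matrix.conjTranspose_mul, Matrix.mul_assoc])
  · exact e2'.trans (by
      rw [hM, show m.2.1 (Fin.succ (Fin.succ 0)) = _ from e2]
      simp [Matrix.conjTranspose_mul, Matrix.mul_assoc])
  · exact e3'.trans (by
      rw [hM, show m.2.1 (Fin.succ (Fin.succ (Fin.succ 0))) = _ from e3]
      simp [Matrix.conjTranspose_mul, Matrix.mul_assoc])

/-- Equivalent pairs of linear maps are complexes simultaneously. -/
theorem MonadEquiv.linMap_mul_eq_zero {m m' : MonadData k} (h : MonadEquiv m m')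
    (hc : linMap a b m.2.1 * linMap a b m.1 = 0) : linMap a b m'.2.1 * linMap a b m'.1 = 0 := by
  obtain ⟨U, W, hM, hN, -⟩ := h
  have hU : (U : Matrix (KIdx k) (KIdx k) ℂ)ᴴ * (U : Matrix (KIdx k) (KIdx k) ℂ) = 1 :=
    Matrix.UnitaryGroup.star_mul_self U
  -- All products `NⁱMʲ` transform by the same linear map `X ↦ W*XW`, so every linear equation among
  -- them is preserved.
  have key : ∀ i j, m'.2.1 i * m'.1 j = (W : Matrix (Fin k) (Fin k) ℂ)ᴴ *
      (m.2.1 i * m.1 j) * (W : Matrix (Fin k) (Fin k) ℂ) := by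
    intro i j
    rw [hM, hN]
    simp only [Matrix.mul_assoc]
    rw [← Matrix.mul_assoc _ (U : Matrix (KIdx k) (KIdx k) ℂ) _, hU, Matrix.one_mul]
  rw [linMap_mul_linMap_eq_zero_iff] at hc ⊢
  have smul : ∀ (c : ℂ) (X : Matrix (Fin k) (Fin k) ℂ),
      c • ((W : Matrix (Fin k) (Fin k) ℂ)ᴴ * X * (W : Matrix (Fin k) (Fin k) ℂ)) =
        (W : Matrix (Fin k) (Fin k) ℂ)ᴴ * (c • X) * (W : Matrix (Fin k) (Fin k) ℂ) := by
    simp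
  obtain ⟨h1, h2, h3, h4, h5, h6, h7⟩ := hc
  simp only [key, smul, ← Matrix.add_mul, ← Matrix.mul_add, h1, h2, h3, h4, h5, h6, h7,
    Matrix.mul_zero, Matrix.zero_mul, implies_true, and_self]

theorem monadEquiv_monadOf_unitaryAct (g : Matrix.unitaryGroup (Fin k) ℂ) (x : ADHMData k) :
    MonadEquiv (monadOf x) (monadOf (unitaryAct g x)) := by
  have hg : (g : Matrix (Fin k) (Fin k) ℂ) * (g : Matrix (Fin k) (Fin k) ℂ)ᴴ = 1 :=
    Unitary.mul_star_self_of_mem g.2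
  have hg' : (g : Matrix (Fin k) (Fin k) ℂ)ᴴ * (g : Matrix (Fin k) (Fin k) ℂ) = 1 :=
    Unitary.star_mul_self_of_mem g.2
  have hi : ((g⁻¹ : Matrix.unitaryGroup (Fin k) ℂ) : Matrix (Fin k) (Fin k) ℂ) =
      (g : Matrix (Fin k) (Fin k) ℂ)ᴴ := rfl
  -- `diag(g, g, 1)` on `K` together with `g⁻¹` on `H` fixes `M³`, `M⁴` and `φ` of the normal form.
  let V : Matrix (KIdx k) (KIdx k) ℂ :=
    Matrix.fromBlocks (g : Matrix (Fin k) (Fin k) ℂ) 0 0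
      (Matrix.fromBlocks (g : Matrix (Fin k) (Fin k) ℂ) 0 0 1)
  have hV : V ∈ Matrix.unitaryGroup (KIdx k) ℂ := by
    rw [Matrix.mem_unitaryGroup_iff, Matrix.star_eq_conjTranspose]
    simp [V, Matrix.fromBlocks_conjTranspose, Matrix.fromBlocks_multiply, hg]
  refine MonadEquiv.of_isSelfConjugate (U := ⟨V, hV⟩) (W := ⟨(g : Matrix (Fin k) (Fin k) ℂ)ᴴ,
    (g : Matrix (Fin k) (Fin k) ℂ), hg', hg⟩) (isSelfConjugate_monadOf _)
    (isSelfConjugate_monadOf _) (fun j => ?_) ?_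
  · fin_cases j <;>
      simp [V, monadOf, unitaryAct, hi, hg, Matrix.fromBlocks_mul_fromRows, Matrix.fromRows_mul,
        Matrix.conjTranspose_mul, Matrix.mul_assoc]
  · simp [V, monadOf, Matrix.fromBlocks_mul_fromRows]

/-- Both monads share `M³`, `M⁴` and `φ`. An equivalence fixing these has `W` unitary and `U =
diag(W*, W*, 1)`, so it is the action of `g = W*`. -/
theorem exists_unitaryAct_of_monadEquiv {x y : ADHMData k}
    (h : MonadEquiv (monadOf x) (monadOf y)) :
    ∃ g : Matrix.unitaryGroup (Fin k) ℂ, unitaryAct g x = y := by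
  obtain ⟨⟨U, hU⟩, W, hM, -, hφ⟩ := h
  obtain ⟨W, Wi, hW, hW'⟩ := W
  have hUU : Uᴴ * U = 1 := Matrix.mem_unitaryGroup_iff'.mp hU
  dsimp only at hM hφ
  set E₁ : Matrix (KIdx k) (Fin k) ℂ := Matrix.fromRows 1 (Matrix.fromRows 0 0) with hE₁
  set E₂ : Matrix (KIdx k) (Fin k) ℂ := Matrix.fromRows 0 (Matrix.fromRows 1 0) with hE₂
  set E₃ : Matrix (KIdx k) (Fin 2) ℂ := Matrix.fromRows 0 (Matrix.fromRows 0 1) with hE₃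
  have h1 : E₁ = U * E₁ * W := hM 2
  have h2 : E₂ = U * E₂ * W := hM 3
  have h3 : E₃ = U * E₃ := hφ
  have k1 : E₁ᴴ * U = Wᴴ * E₁ᴴ := by
    conv_lhs => rw [h1]
    simp only [Matrix.conjTranspose_mul, Matrix.mul_assoc, hUU, Matrix.mul_one]
  have k2 : E₂ᴴ * U = Wᴴ * E₂ᴴ := by
    conv_lhs => rw [h2]
    simp only [Matrix.conjTranspose_mul, Matrix.mul_assoc, hUU, Matrix.mul_one]
  have k3 : E₃ᴴ * U = E₃ᴴ := by
    conv_lhs => rw [h3]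
    simp only [Matrix.conjTranspose_mul, Matrix.mul_assoc, hUU, Matrix.mul_one]
  have hWW : Wᴴ * W = 1 := by
    have e : E₁ᴴ * E₁ = 1 := by
      simp [hE₁, Matrix.conjTranspose_fromRows_eq_fromCols_conjTranspose,
        Matrix.fromCols_mul_fromRows]
    calc Wᴴ * W = Wᴴ * (E₁ᴴ * E₁) * W := by rw [e, Matrix.mul_one]
      _ = E₁ᴴ * (U * E₁ * W) := by rw [← Matrix.mul_assoc, ← k1]; simp only [Matrix.mul_assoc]
      _ = 1 := by rw [← h1, e]
  have hWW' : W * Wᴴ = 1 := mul_eq_one_comm.mp hWW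
  have r0 : ∀ {m : ℕ} (E : Matrix (KIdx k) (Fin m) ℂ) (F : Matrix (Fin m) (KIdx k) ℂ) (j : Fin 4),
      Eᴴ * U = F → Eᴴ * (monadOf y).1 j = F * (monadOf x).1 j * W := by
    intro m E F j hF
    rw [hM j, ← hF]
    simp only [Matrix.mul_assoc]
  have b1 := r0 E₁ _ 0 k1
  have b2 := r0 E₂ _ 0 k2
  have bJ := r0 E₃ _ 0 k3
  -- Among the `Mʲ`, the matrix `I` occurs only as `I*`, in the last block of `M²`; hence the
  -- adjoint taken below.
  have bI := r0 E₃ _ 1 k3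
  simp only [hE₁, hE₂, hE₃, monadOf, Matrix.cons_val_zero, Matrix.cons_val_one, Matrix.mul_assoc,
    Matrix.conjTranspose_fromRows_eq_fromCols_conjTranspose,
    Matrix.fromCols_mul_fromRows, Matrix.conjTranspose_one, Matrix.conjTranspose_zero,
    Matrix.one_mul, Matrix.zero_mul, add_zero, zero_add] at b1 b2 bJ bI
  have bI' := congrArg Matrix.conjTranspose bI
  simp only [Matrix.conjTranspose_mul, Matrix.conjTranspose_conjTranspose] at bI'
  have hg : Wᴴ ∈ Matrix.unitaryGroup (Fin k) ℂ := by
    rw [Matrix.mem_unitaryGroup_iff, Matrix.star_eq_conjTranspose,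
      Matrix.conjTranspose_conjTranspose, hWW]
  refine ⟨⟨Wᴴ, hg⟩, ?_⟩
  have hi : (((⟨Wᴴ, hg⟩ : Matrix.unitaryGroup (Fin k) ℂ)⁻¹ : Matrix.unitaryGroup (Fin k) ℂ) :
      Matrix (Fin k) (Fin k) ℂ) = W := Matrix.conjTranspose_conjTranspose W
  refine Prod.ext ?_ (Prod.ext ?_ (Prod.ext ?_ ?_))
  · simp only [unitaryAct, hi, b1, Matrix.mul_assoc]
  · simp only [unitaryAct, hi, b2, Matrix.mul_assoc]
  · simp only [unitaryAct, bI']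
  · simp only [unitaryAct, hi, bJ]

/-! ### The ADHM datum of a framed monad -/

/-- The change of basis of `H` that makes the coefficients of `z₃` and `z₄` isometric. -/
noncomputable def normalizer (m : MonadData k) : Matrix (Fin k) (Fin k) ℂ :=
  invSqrt ((m.1 2)ᴴ * m.1 2)

/-- The ADHM datum of a framed monad: the components of its coefficients with respect to the
orthonormal basis of `K` given by the coefficients of `z₃`, `z₄` and the framing. -/
noncomputable def adhmOf (m : MonadData k) : ADHMData k :=
  ((m.1 2 * normalizer m)ᴴ * (m.1 0 * normalizer m),
    (m.1 3 * normalizer m)ᴴ * (m.1 0 * normalizer m),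
    (m.1 1 * normalizer m)ᴴ * m.2.2,
    m.2.2ᴴ * (m.1 0 * normalizer m))

-- At the classical point `(0, 0, 1, 0)` the fibre of `σ` is `M³` alone, which is therefore
-- injective.
open scoped ComplexOrder in
theorem IsMonad.posDef {M : Fin 4 → Matrix (KIdx k) (Fin k) ℂ}
    {N : Fin 4 → Matrix (Fin k) (KIdx k) ℂ} (h : IsMonad a b M N) : ((M 2)ᴴ * M 2).PosDef := by
  refine Matrix.PosDef.conjTranspose_mul_self _ ?_
  simpa [fibreMap_pointTwo] using h.fibre_injective (pointTwo a b) isClassicalPoint_pointTwo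

/-- Only `normalizer` is not polynomial in the entries and their conjugates; positive definiteness
of the Gram matrix makes it continuous. -/
theorem continuous_adhmOf : Continuous fun m : FramedMonad a b k => adhmOf m.1 := by
  have hM : ∀ j, Continuous fun m : FramedMonad a b k => m.1.1 j := fun j =>
    (continuous_apply j).comp (continuous_fst.comp continuous_subtype_val)
  have hφ : Continuous fun m : FramedMonad a b k => m.1.2.2 :=
    continuous_snd.comp (continuous_snd.comp continuous_subtype_val)
  have hW : Continuous fun m : FramedMonad a b k => normalizer m.1 :=
    continuous_invSqrt ((hM 2).matrix_conjTranspose.matrix_mul (hM 2)) fun m => m.2.1.posDef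
  have hMW := fun j => (hM j).matrix_mul hW
  exact (((hMW 2).matrix_conjTranspose.matrix_mul (hMW 0)).prodMk
    (((hMW 3).matrix_conjTranspose.matrix_mul (hMW 0)).prodMk
      (((hMW 1).matrix_conjTranspose.matrix_mul hφ).prodMk
        (hφ.matrix_conjTranspose.matrix_mul (hMW 0)))))

theorem continuous_monadOf : Continuous (monadOf : ADHMData k → MonadData k) := by
  have rows : ∀ {m₁ m₂ n : Type} {f : ADHMData k → Matrix m₁ n ℂ} {g : ADHMData k → Matrix m₂ n ℂ},
      Continuous f → Continuous g → Continuous fun x => Matrix.fromRows (f x) (g x) := by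
    intro m₁ m₂ n f g hf hg
    refine continuous_matrix fun i j => ?_
    cases i
    exacts [hf.matrix_elem _ j, hg.matrix_elem _ j]
  have cols : ∀ {m n₁ n₂ : Type} {f : ADHMData k → Matrix m n₁ ℂ} {g : ADHMData k → Matrix m n₂ ℂ},
      Continuous f → Continuous g → Continuous fun x => Matrix.fromCols (f x) (g x) := by
    intro m n₁ n₂ f g hf hg
    refine continuous_matrix fun i j => ?_
    cases j
    exacts [hf.matrix_elem i _, hg.matrix_elem i _]
  have c1 : Continuous fun x : ADHMData k => x.1 := continuous_fst
  have c2 : Continuous fun x : ADHMData k => x.2.1 := continuous_fst.comp continuous_snd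
  have cI : Continuous fun x : ADHMData k => x.2.2.1 :=
    continuous_fst.comp (continuous_snd.comp continuous_snd)
  have cJ : Continuous fun x : ADHMData k => x.2.2.2 :=
    continuous_snd.comp (continuous_snd.comp continuous_snd)
  refine Continuous.prodMk (continuous_pi fun j => ?_)
    (Continuous.prodMk (continuous_pi fun j => ?_) continuous_const)
  · fin_cases j
    · exact rows c1 (rows c2 cJ)
    · exact rows c2.matrix_conjTranspose.neg
        (rows c1.matrix_conjTranspose cI.matrix_conjTranspose)
    · exact continuous_const
    · exact continuous_const
  · fin_cases j
    · exact cols c2.neg (cols c1 cI)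
    · exact cols c1.matrix_conjTranspose.neg
        (cols c2.matrix_conjTranspose.neg cJ.matrix_conjTranspose.neg)
    · exact continuous_const
    · exact continuous_const

/-- By self-conjugacy the `z₃²` and `z₃z₄` equations give `M⁴*M³ = 0` and `M⁴*M⁴ = M³*M³`, and the
framing maps onto the common kernel of `M³*` and `M⁴*`. The `z₂z₃` and `z₂z₄` equations then express
two blocks of `M²` through `M¹`. -/
theorem monadEquiv_monadOf_adhmOf (m : FramedMonad a b k) :
    MonadEquiv m.1 (monadOf (adhmOf m.1)) := by
  obtain ⟨⟨M, N, φ⟩, hm, hs, hf⟩ := m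
  dsimp only at hm hs hf ⊢
  have hP := hm.posDef
  have hc := linMap_mul_linMap_eq_zero_iff.mp hm.complex
  obtain ⟨n0, n1, n2, n3⟩ := hs
  obtain ⟨hdiag, -, -, h12, h13, h23, -⟩ := hc
  replace hdiag := hdiag 2
  rw [n2] at hdiag
  rw [n1, n2] at h12
  rw [n1, n3] at h13
  rw [n2, n3] at h23
  set W := normalizer (M, N, φ) with hW
  have hWU : IsUnit W := isUnit_invSqrt hP
  have hWs : Wᴴ = W := conjTranspose_invSqrt _
  have hWP : Wᴴ * ((M 2)ᴴ * M 2) * W = 1 := by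
    rw [hWs, Matrix.mul_assoc]; exact invSqrt_mul_mul_invSqrt hP
  have h32 : (M 3)ᴴ * M 2 = 0 := hdiag
  have h23' : (M 2)ᴴ * M 3 = 0 := by simpa using congrArg Matrix.conjTranspose h32
  have h33 : (M 3)ᴴ * M 3 = (M 2)ᴴ * M 2 := by
    rwa [Matrix.neg_mul, ← sub_eq_add_neg, sub_eq_zero] at h23
  have hNφ : ∀ j : Fin 4, (∀ w, N j *ᵥ (φ *ᵥ w) = 0) → N j * φ = 0 := by
    intro j h
    ext r t
    have h1 := congrFun (h (Pi.single t 1)) r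
    rw [Matrix.mulVec_mulVec, Matrix.mulVec_single_one] at h1
    exact h1
  have h3φ : (M 3)ᴴ * φ = 0 := by
    rw [← n2]; exact hNφ 2 fun w => ((hf.2 _).mpr ⟨w, rfl⟩).1
  have h2φ : (M 2)ᴴ * φ = 0 := by
    have := hNφ 3 fun w => ((hf.2 _).mpr ⟨w, rfl⟩).2
    rwa [n3, Matrix.neg_mul, neg_eq_zero] at this
  have hφ3 : φᴴ * M 3 = 0 := by simpa using congrArg Matrix.conjTranspose h3φ
  have hφ2 : φᴴ * M 2 = 0 := by simpa using congrArg Matrix.conjTranspose h2φ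
  have red : ∀ (X Y : Matrix (KIdx k) (Fin k) ℂ), (X * W)ᴴ * (Y * W) = Wᴴ * (Xᴴ * Y) * W := by
    intro X Y
    simp only [Matrix.conjTranspose_mul, Matrix.mul_assoc]
  let V : Matrix (KIdx k) (KIdx k) ℂ :=
    Matrix.fromRows (M 2 * W)ᴴ (Matrix.fromRows (M 3 * W)ᴴ φᴴ)
  -- `V Vᴴ` is the Gram matrix of the columns of `M³W`, `M⁴W` and `φ`.
  have hV : V ∈ Matrix.unitaryGroup (KIdx k) ℂ := by
    rw [Matrix.mem_unitaryGroup_iff, Matrix.star_eq_conjTranspose]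
    have e23 : (M 2 * W)ᴴ * (M 3 * W) = 0 := by rw [red, h23']; simp
    have e32 : (M 3 * W)ᴴ * (M 2 * W) = 0 := by rw [red, h32]; simp
    have e22 : (M 2 * W)ᴴ * (M 2 * W) = 1 := by rw [red, hWP]
    have e33 : (M 3 * W)ᴴ * (M 3 * W) = 1 := by rw [red, h33, hWP]
    have e2φ : (M 2 * W)ᴴ * φ = 0 := by rw [Matrix.conjTranspose_mul, Matrix.mul_assoc, h2φ]; simp
    have e3φ : (M 3 * W)ᴴ * φ = 0 := by rw [Matrix.conjTranspose_mul, Matrix.mul_assoc, h3φ]; simp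
    have eφ2 : φᴴ * (M 2 * W) = 0 := by rw [← Matrix.mul_assoc, hφ2]; simp
    have eφ3 : φᴴ * (M 3 * W) = 0 := by rw [← Matrix.mul_assoc, hφ3]; simp
    rw [← Matrix.fromBlocks_one, ← Matrix.fromBlocks_one]
    simp only [V, Matrix.conjTranspose_fromRows_eq_fromCols_conjTranspose,
      Matrix.conjTranspose_conjTranspose, Matrix.fromRows_mul, Matrix.mul_fromCols, e22, e33, e23,
      e32, e2φ, e3φ, eφ2, eφ3, hf.1, Matrix.fromRows_zero]
    ext (i | i | i) (j | j | j) <;> rfl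
  have hM0 : V * M 0 * W = (monadOf (adhmOf (M, N, φ))).1 0 := by
    simp [V, monadOf, adhmOf, Matrix.fromRows_mul, Matrix.mul_assoc, ← hW]
  have hM1 : V * M 1 * W = (monadOf (adhmOf (M, N, φ))).1 1 := by
    have i1 : (M 2 * W)ᴴ * (M 1 * W) = -((M 3 * W)ᴴ * (M 0 * W))ᴴ := by
      rw [red, Matrix.conjTranspose_mul, Matrix.conjTranspose_conjTranspose, red,
        ← Matrix.neg_mul, ← Matrix.mul_neg]
      congr 2
      rw [Matrix.neg_mul, Matrix.neg_mul] at h13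
      rw [eq_neg_iff_add_eq_zero, ← neg_eq_zero, neg_add_rev, h13]
    have i2 : (M 3 * W)ᴴ * (M 1 * W) = ((M 2 * W)ᴴ * (M 0 * W))ᴴ := by
      rw [red, Matrix.conjTranspose_mul, Matrix.conjTranspose_conjTranspose, red]
      congr 2
      rwa [Matrix.neg_mul, neg_add_eq_zero, eq_comm] at h12
    have i3 : φᴴ * (M 1 * W) = ((M 1 * W)ᴴ * φ)ᴴ := by
      rw [Matrix.conjTranspose_mul, Matrix.conjTranspose_conjTranspose]
    rw [Matrix.mul_assoc]
    simp only [V, Matrix.fromRows_mul, i1, i2, i3]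
    rfl
  have hM2 : V * M 2 * W = (monadOf (adhmOf (M, N, φ))).1 2 := by
    rw [Matrix.mul_assoc]
    simp only [V, monadOf, Matrix.fromRows_mul, red, hWP, h32, Matrix.mul_zero, Matrix.zero_mul,
      ← Matrix.mul_assoc φᴴ, hφ2]
    rfl
  have hM3 : V * M 3 * W = (monadOf (adhmOf (M, N, φ))).1 3 := by
    rw [Matrix.mul_assoc]
    simp only [V, monadOf, Matrix.fromRows_mul, red, hWP, h33, h23', Matrix.mul_zero,
      Matrix.zero_mul, ← Matrix.mul_assoc φᴴ, hφ3]
    rfl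
  refine MonadEquiv.of_isSelfConjugate (U := ⟨V, hV⟩) (W := hWU.unit) ⟨n0, n1, n2, n3⟩
    (isSelfConjugate_monadOf _) (fun j => ?_) ?_
  · fin_cases j
    exacts [hM0.symm, hM1.symm, hM2.symm, hM3.symm]
  · simp only [V, monadOf, Matrix.fromRows_mul, Matrix.conjTranspose_mul, Matrix.mul_assoc, h2φ,
      h3φ, hf.1, Matrix.mul_zero]

/-- The ADHM datum of a framed monad solves the ADHM equations. -/
theorem adhmEquations_adhmOf (m : FramedMonad a b k) : ADHMEquations (a + b) (adhmOf m.1) :=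
  (linMap_monadOf_mul_eq_zero_iff _).mp
    ((monadEquiv_monadOf_adhmOf m).linMap_mul_eq_zero m.2.1.complex)

/-! ### The homeomorphism of moduli spaces -/

/-- The framed monad of a solution of the ADHM equations. -/
def framedMonadOf (ha : a ≠ 0) (hb : b ≠ 0) (hab : a + b ≠ 0) (x : ADHMSolution (a + b) k) :
    FramedMonad a b k :=
  ⟨monadOf x.1, isMonad_monadOf ha hb hab x.2, isSelfConjugate_monadOf x.1,
    isFraming_monadOf x.1⟩

/-- The ADHM construction, as a homeomorphism of moduli spaces. -/
noncomputable def adhmHomeomorph (ha : a ≠ 0) (hb : b ≠ 0) (hab : a + b ≠ 0) (k : ℕ) :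
    Quotient (adhmSetoid (a + b) k) ≃ₜ Quotient (framedMonadSetoid a b k) where
  toFun := Quotient.map (framedMonadOf ha hb hab) (by
    rintro x y ⟨g, hg⟩
    have h := monadEquiv_monadOf_unitaryAct g x.1
    rw [hg] at h
    exact h)
  invFun := Quotient.map (fun m => ⟨adhmOf m.1, adhmEquations_adhmOf m⟩) (by
    intro m m' h
    exact exists_unitaryAct_of_monadEquiv
      (((monadEquiv_monadOf_adhmOf m).symm.trans h).trans (monadEquiv_monadOf_adhmOf m')))
  -- The equivalence of a framed monad with its normal form settles both composites; `adhmOf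
  -- (monadOf x)` need not be computed.
  left_inv := by
    intro q
    induction q using Quotient.inductionOn with
    | h x =>
      exact Quotient.sound (exists_unitaryAct_of_monadEquiv
        (monadEquiv_monadOf_adhmOf (framedMonadOf ha hb hab x)).symm)
  right_inv := by
    intro q
    induction q using Quotient.inductionOn with
    | h m => exact Quotient.sound (monadEquiv_monadOf_adhmOf m).symm
  continuous_toFun := Continuous.quotient_map'
    ((continuous_monadOf.comp continuous_subtype_val).subtype_mk _) _
  continuous_invFun := Continuous.quotient_map' (continuous_adhmOf.subtype_mk _) _

end MoyalADHM

theorem mainTheorem1 (ħ : ℝ) (hħ : 0 < ħ) (α β : ℂ) (hα : α ≠ 0) (hβ : β ≠ 0) (hαβ : α + β ≠ 0)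
    (k : ℕ) (hk : 0 < k) :
    ∃ e : Quotient (MoyalADHM.adhmSetoid (Complex.I * ħ * (α + β)) k) ≃ₜ
        Quotient (MoyalADHM.framedMonadSetoid (Complex.I * ħ * α) (Complex.I * ħ * β) k),
      ∀ x : MoyalADHM.ADHMSolution (Complex.I * ħ * (α + β)) k,
        ∃ m : MoyalADHM.FramedMonad (Complex.I * ħ * α) (Complex.I * ħ * β) k,
          m.1 = MoyalADHM.monadOf x.1 ∧ e (Quotient.mk _ x) = Quotient.mk _ m := by
  have hc : Complex.I * ħ ≠ 0 := by simp [hħ.ne']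
  -- This puts the ADHM parameter in the form `a + b`.
  rw [mul_add]
  have hab : Complex.I * ħ * α + Complex.I * ħ * β ≠ 0 := by
    rw [← mul_add]
    exact mul_ne_zero hc hαβ
  exact ⟨MoyalADHM.adhmHomeomorph (mul_ne_zero hc hα) (mul_ne_zero hc hβ) hab k, fun x =>
    ⟨MoyalADHM.framedMonadOf (mul_ne_zero hc hα) (mul_ne_zero hc hβ) hab x, rfl, rfl⟩⟩
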